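/- Let $n$ be a natural number, let $\mathbb B_n$ be the open unit ball of $\mathbb C^n$, let $\gamma>0$ be real, and for $w\in\mathbb B_n$ put $K_w(z)=(1-\langle z,w\rangle)^{-\gamma}$ (principal branch), where $\langle z,w\rangle=\sum_j z_j\overline{w_j}$. Let $H_\gamma$ be the Hilbert space of functions on $\mathbb B_n$ with reproducing kernel $K_w(z)$, that is, the completion of the linear span of the functions $K_w$, $w\in\mathbb B_n$, under the inner product with $\langle K_z,K_w\rangle=K_z(w)$. For $f:\mathbb B_n\to\mathbb C$ and $\varphi:\mathbb B_n\to\mathbb B_n$ let $W_{f,\varphi}h=f\cdot(h\circ\varphi)$; it is a bounded operator on $H_\gamma$ if it maps all of $H_\gamma$ into $H_\gamma$ and is bounded there. **Theorem.** Let $f,g:\mathbb B_n\to\mathbb C$ be analytic functions and $\varphi,\psi:\mathbb B_n\to\mathbb B_n$ analytic self-maps. Then $W_{f,\varphi}$ and $W_{g,\psi}$ are nonzero bounded operators on $H_\gamma$ with $W_{g,\psi}^*=W_{f,\varphi}$ if and only if there are vectors $c,d\in\mathbb B_n$, a linear operator $A$ on $\mathbb C^n$ and a nonzero complex number $\alpha$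 such that for all $z\in\mathbb B_n$ $$\varphi(z)=\frac{d+Az}{1-\langle z,c\rangle},\qquad \psi(z)=\frac{c+A^*z}{1-\langle z,d\rangle},$$ and $$f=\alpha K_c=\alpha K_{\psi(0)},\qquad g=\overline{\alpha}K_d=\overline{\alpha}K_{\varphi(0)},\qquad c=\psi(0),\quad d=\varphi(0).$$ In particular, in that case $\varphi$ and $\psi$ are linear fractional maps, and $\psi$ is the Cowen–MacCluer adjoint map of $\varphi$: there are a linear operator $M$ on $\mathbb C^n$, vectors $B,C\in\mathbb C^n$ and $D\in\mathbb C$ such that for all $z\in\mathbb B_n$ $$\varphi(z)=\frac{Mz+B}{\langle z,C\rangle+D},\qquad \psi(z)=\frac{M^*z-C}{-\langle z,B\rangle+\overline{D}},$$ with denominators that do not vanish on $\mathbb B_n$. -/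

import Mathlib

noncomputable section

/-- `ℂⁿ` with its Euclidean inner product. -/
abbrev Cn (n : ℕ) : Type := EuclideanSpace ℂ (Fin n)

/-- The open unit ball `𝔹ₙ` of `ℂⁿ`, as a type. -/
abbrev UnitBall (n : ℕ) : Type := Metric.ball (0 : Cn n) 1

/-- The origin, as a point of the ball. -/
def UnitBall.origin (n : ℕ) : UnitBall n := ⟨0, Metric.mem_ball_self one_pos⟩

/-- A map on the ball is analytic. -/
def AnalyticOnBall {n : ℕ} {V : Type*} [NormedAddCommGroup V] [NormedSpace ℂ V]
    (F : UnitBall n → V) : Prop :=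
  ∃ G : Cn n → V, AnalyticOnNhd ℂ G (Metric.ball 0 1) ∧ ∀ z : UnitBall n, F z = G z

/-- The kernel function `K_w(z) = (1 - ⟨z, w⟩)^{-γ}` with the principal branch of the power; recall
that Mathlib's `inner ℂ w z` is linear in `z` and conjugate-linear in `w`, i.e. it is `⟨z, w⟩`. -/
def ballKernel {n : ℕ} (γ : ℝ) (w z : UnitBall n) : ℂ :=
  1 / (1 - inner ℂ (w : Cn n) (z : Cn n)) ^ (γ : ℂ)

/-- The kernel `(z, w) ↦ K_w(z)` as an operator-valued matrix: the entry at `(z, w)` is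
multiplication by `K_w(z)` on `ℂ`. -/
def ballKernelMatrix (n : ℕ) (γ : ℝ) : Matrix (UnitBall n) (UnitBall n) (ℂ →L[ℂ] ℂ) :=
  fun z w => ballKernel γ w z • ContinuousLinearMap.id ℂ ℂ

lemma norm_inner_ball_lt {n : ℕ} (w z : UnitBall n) :
    ‖inner ℂ (w : Cn n) (z : Cn n)‖ < 1 := by
  have hw := mem_ball_zero_iff.1 w.2
  have hz := mem_ball_zero_iff.1 z.2
  have h := norm_inner_le_norm (𝕜 := ℂ) (w : Cn n) (z : Cn n)
  nlinarith [norm_nonneg (w : Cn n), norm_nonneg (z : Cn n)]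

lemma ring_choose_nonneg {γ : ℝ} (hγ : 0 < γ) (k : ℕ) : 0 ≤ Ring.choose (γ + k - 1) k := by
  rw [← Ring.multichoose_eq]
  have h := Ring.factorial_nsmul_multichoose_eq_ascPochhammer γ k
  rw [Polynomial.ascPochhammer_smeval_eq_eval] at h
  have hp := ascPochhammer_pos k γ hγ
  rw [← h, nsmul_eq_mul] at hp
  have : (0 : ℝ) < k.factorial := by exact_mod_cast k.factorial_pos
  exact (pos_of_mul_pos_right hp this.le).le

lemma ballKernel_hasSum {n : ℕ} (γ : ℝ) (w z : UnitBall n) :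
    HasSum (fun k : ℕ => ((Ring.choose (γ + k - 1) k : ℝ) : ℂ) *
      inner ℂ (w : Cn n) (z : Cn n) ^ k) (ballKernel γ w z) := by
  have h := (Complex.one_div_one_sub_cpow_hasFPowerSeriesOnBall_zero (γ : ℂ)).hasSum
    (y := inner ℂ (w : Cn n) (z : Cn n)) (by
      rw [← ENNReal.ofReal_one, Metric.eball_ofReal]
      simpa using norm_inner_ball_lt w z)
  simp only [FormalMultilinearSeries.ofScalars_apply_eq, zero_add, smul_eq_mul] at h
  have e : (fun k : ℕ => ((Ring.choose (γ + k - 1) k : ℝ) : ℂ) *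
      inner ℂ (w : Cn n) (z : Cn n) ^ k) = fun k : ℕ => Ring.choose ((γ : ℂ) + k - 1) k *
      inner ℂ (w : Cn n) (z : Cn n) ^ k := by
    funext k
    rw [Complex.ofReal_choose]
    push_cast
    rfl
  rw [e]
  exact h

lemma ballKernel_conj {n : ℕ} (γ : ℝ) (w z : UnitBall n) :
    star (ballKernel γ w z) = ballKernel γ z w := by
  have h := (ballKernel_hasSum γ w z).star
  refine h.unique ?_
  convert ballKernel_hasSum γ z w using 2 with k
  simp

open scoped ComplexOrder in
lemma ballKernel_quadratic_nonneg {n : ℕ} {γ : ℝ} (hγ : 0 < γ) (s : Finset (UnitBall n))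
    (v : UnitBall n → ℂ) :
    0 ≤ (∑ x ∈ s, ∑ y ∈ s, star (v x) * ballKernel γ x y * v y).re := by
  have hs : HasSum (fun k : ℕ => ∑ x ∈ s, ∑ y ∈ s, star (v x) *
      (((Ring.choose (γ + k - 1) k : ℝ) : ℂ) * inner ℂ (x : Cn n) (y : Cn n) ^ k) * v y)
      (∑ x ∈ s, ∑ y ∈ s, star (v x) * ballKernel γ x y * v y) :=
    hasSum_sum fun x _ => hasSum_sum fun y _ => ((ballKernel_hasSum γ x y).mul_left _).mul_right _
  refine (Complex.hasSum_re hs).nonneg fun k => ?_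
  have hpow : ∀ k : ℕ, (Matrix.of fun x y : s =>
      inner ℂ (x : Cn n) (y : Cn n) ^ k : Matrix s s ℂ).PosSemidef := by
    intro k
    induction k with
    | zero =>
      have := Matrix.posSemidef_vecMulVec_self_star (fun _ : s => (1 : ℂ))
      refine (congrArg Matrix.PosSemidef ?_).mp this
      ext x y
      simp [Matrix.vecMulVec]
    | succ k ih =>
      have := ih.hadamard (Matrix.posSemidef_gram ℂ (fun x : s => ((x : UnitBall n) : Cn n)))
      refine (congrArg Matrix.PosSemidef ?_).mp this
      ext x y
      simp [Matrix.gram_apply, pow_succ]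
  have h := (hpow k).dotProduct_mulVec_nonneg (fun x => v x)
  have h2 := mul_nonneg (ring_choose_nonneg hγ k) (Complex.nonneg_iff.1 h).1
  rw [← Complex.re_ofReal_mul] at h2
  convert h2 using 2
  rw [← Finset.sum_coe_sort s]
  simp only [dotProduct, Matrix.mulVec, Finset.mul_sum, Pi.star_apply, Matrix.of_apply]
  refine Finset.sum_congr rfl fun x _ => ?_
  rw [← Finset.sum_coe_sort s]
  refine Finset.sum_congr rfl fun y _ => ?_
  ring

lemma ballKernelMatrix_posSemidef (n : ℕ) {γ : ℝ} (hγ : 0 < γ) :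
    (ballKernelMatrix n γ).PosSemidef := by
  have key := (RKHS.posSemidef_tfae (K := ballKernelMatrix n γ)).out 0 2
  refine key.mpr ⟨?_, fun v => ?_⟩
  · have hid : star (ContinuousLinearMap.id ℂ ℂ) = ContinuousLinearMap.id ℂ ℂ :=
      star_one (ℂ →L[ℂ] ℂ)
    ext z w
    simp only [Matrix.conjTranspose_apply, ballKernelMatrix, star_smul, ballKernel_conj, hid]
  · have h := ballKernel_quadratic_nonneg hγ v.support (fun x => star (v x))
    rw [Finset.sum_comm] at h
    refine h.trans_eq ?_
    simp only [Finsupp.sum, ballKernelMatrix]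
    refine congrArg Complex.re ?_
    refine Finset.sum_congr rfl fun x _ => Finset.sum_congr rfl fun y _ => ?_
    have := ballKernel_conj γ x y
    simp only [RCLike.star_def] at this
    simp [this]
    ring

instance (n : ℕ) (γ : ℝ) [hγ : Fact (0 < γ)] : Fact (ballKernelMatrix n γ).PosSemidef :=
  ⟨ballKernelMatrix_posSemidef n hγ.out⟩

/-- The Hilbert space `H_γ`: the completion of the span of the kernel functions `K_w` with respect
to `⟨K_z, K_w⟩ = K_z(w)`. A vector `h : HGamma n γ` is a function on the ball through the coercion
`h z`, which is the inner product of `h` with `K_z`. -/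
abbrev HGamma (n : ℕ) (γ : ℝ) [Fact (0 < γ)] : Type := RKHS.OfKernel (ballKernelMatrix n γ)

/-- The reproducing kernel of `HGamma n γ` is `K_w(z)`. -/
lemma kerFun_HGamma_apply {n : ℕ} {γ : ℝ} [Fact (0 < γ)] (w z : UnitBall n) :
    RKHS.kerFun (HGamma n γ) w 1 z = ballKernel γ w z := by
  rw [RKHS.kerFun_apply, RKHS.OfKernel.kernel_ofKernel]
  simp [ballKernelMatrix]

/-- `T` is the weighted composition operator `W_{f,φ} : h ↦ f · (h ∘ φ)`, defined on all of `H_γ`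
and bounded. Since vectors of `H_γ` are determined by their values, there is at most one such `T`;
there is one exactly when `W_{f,φ}` is a bounded operator on `H_γ`. -/
def IsWeightedComp {n : ℕ} {γ : ℝ} [Fact (0 < γ)] (f : UnitBall n → ℂ)
    (φ : UnitBall n → UnitBall n) (T : HGamma n γ →L[ℂ] HGamma n γ) : Prop :=
  ∀ (h : HGamma n γ) (z : UnitBall n), T h z = f z * h (φ z)

/-- `W_{f,φ}` and `W_{g,ψ}` are nonzero bounded operators on `H_γ` and `W_{g,ψ}* = W_{f,φ}`. -/
def WeightedCompAdjoint {n : ℕ} (γ : ℝ) [Fact (0 < γ)] (f g : UnitBall n → ℂ)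
    (φ ψ : UnitBall n → UnitBall n) : Prop :=
  ∃ S T : HGamma n γ →L[ℂ] HGamma n γ, IsWeightedComp f φ S ∧ IsWeightedComp g ψ T ∧
    S ≠ 0 ∧ T ≠ 0 ∧ ContinuousLinearMap.adjoint T = S

/-- The coefficients of a linear fractional expression `z ↦ (Az + B) / (⟨z, C⟩ + D)` on `ℂⁿ`. -/
structure LinFrac (n : ℕ) where
  A : Cn n →ₗ[ℂ] Cn n
  B : Cn n
  C : Cn n
  D : ℂ

/-- The denominator `⟨z, C⟩ + D`. -/
def LinFrac.denom {n : ℕ} (L : LinFrac n) (z : Cn n) : ℂ := inner ℂ L.C z + L.D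

/-- The coefficients of the Cowen–MacCluer adjoint `z ↦ (A*z - C) / (-⟨z, B⟩ + conj D)`. -/
def LinFrac.adjoint {n : ℕ} (L : LinFrac n) : LinFrac n where
  A := LinearMap.adjoint L.A
  B := -L.C
  C := -L.B
  D := star L.D

/-- The self-map `φ` of the ball is given by the linear fractional expression `L`, whose
denominator has no zero on the ball. -/
def LinFrac.Represents {n : ℕ} (L : LinFrac n) (φ : UnitBall n → UnitBall n) : Prop :=
  ∀ z : UnitBall n, L.denom z ≠ 0 ∧ (φ z : Cn n) = (L.denom z)⁻¹ • (L.A z + L.B)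

/-- `φ` is a linear fractional self-map of the ball. -/
def IsLinFracMap {n : ℕ} (φ : UnitBall n → UnitBall n) : Prop :=
  ∃ L : LinFrac n, L.Represents φ

/-- `ψ` is the Cowen–MacCluer adjoint of the linear fractional self-map `φ` of the ball. The
coefficients of a nonconstant `φ` are unique up to a common factor, which does not affect the
adjoint map; for a constant `φ` the adjoint depends on the expression by which `φ` is given. -/
def IsAdjointMap {n : ℕ} (φ ψ : UnitBall n → UnitBall n) : Prop :=
  ∃ L : LinFrac n, L.Represents φ ∧ L.adjoint.Represents ψ

end

noncomputable section

open scoped InnerProductSpace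

/-! Pair $W_{f,\varphi}=W_{g,\psi}^*$ with kernel functions:
$f(z)K_w(\varphi(z))=\overline{g(w)}K_{\psi(w)}(z)$. Setting $w=0$ or $z=0$ shows that $f$ and $g$
are multiples of $K_c$ and $K_d$, where $c=\psi(0)$ and $d=\varphi(0)$. After cancellation the
exponent $\gamma$ can be removed, since logarithms are continuous on the connected ball, which
leaves $(1-\langle z,c\rangle)(1-\langle\varphi(z),w\rangle)=(1-\langle d,w\rangle)(1-\langle
z,\psi(w)\rangle)$. This says that $(1-\langle z,c\rangle)\varphi(z)-d$ and $(1-\langle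
w,d\rangle)\psi(w)-c$ are formally adjoint maps, hence linear.

Conversely the formulas give this relation, and so formal adjointness on kernel functions. The
difficulty is boundedness (`exists_continuousLinearMap_of_formal_adjoint`). The relation at
$w=\varphi(z)$ bounds both shifts on single kernel functions only. Their composition is symmetric,
and its iterates on any finite combination grow geometrically at a rate independent of the
combination; for a symmetric map this rate bounds the norm. -/

/-- A sequence that is log-convex along doublings and grows at most like `C ^ m` satisfies
`a 1 ≤ C * a 0`. -/
lemma le_mul_of_sq_le_mul_of_le_geometric {a : ℕ → ℝ} (ha : ∀ m, 0 ≤ a m)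
    (hsq : ∀ m, a m ^ 2 ≤ a 0 * a (2 * m)) {M C : ℝ} (hC : 0 < C)
    (hM : ∀ m, a m ≤ M * C ^ m) : a 1 ≤ C * a 0 := by
  rcases (ha 0).eq_or_lt with h0 | h0
  · have := hsq 1
    rw [← h0, zero_mul] at this
    rw [← h0, mul_zero]
    nlinarith [ha 1]
  -- Division-free form of `(a 1 / a 0) ^ 2 ^ k ≤ a (2 ^ k) / a 0`.
  have hpow : ∀ k : ℕ, a 1 ^ 2 ^ k * a 0 ≤ a 0 ^ 2 ^ k * a (2 ^ k) := by
    intro k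
    induction k with
    | zero => simp [mul_comm]
    | succ k ih =>
      have h1 : (a 1 ^ 2 ^ k * a 0) ^ 2 ≤ (a 0 ^ 2 ^ k * a (2 ^ k)) ^ 2 :=
        pow_le_pow_left₀ (mul_nonneg (pow_nonneg (ha 1) _) h0.le) ih 2
      have h2 : (a 0 ^ 2 ^ k * a (2 ^ k)) ^ 2 ≤
          (a 0 ^ 2 ^ k) ^ 2 * (a 0 * a (2 * 2 ^ k)) := by
        rw [mul_pow]
        exact mul_le_mul_of_nonneg_left (hsq _) (sq_nonneg _)
      have h3 : a 0 * (a 1 ^ 2 ^ (k + 1) * a 0) ≤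
          a 0 * (a 0 ^ 2 ^ (k + 1) * a (2 ^ (k + 1))) := by
        calc _ = (a 1 ^ 2 ^ k * a 0) ^ 2 := by ring
          _ ≤ _ := h1.trans h2
          _ = _ := by rw [show 2 * 2 ^ k = 2 ^ (k + 1) by ring]; ring
      exact le_of_mul_le_mul_left h3 h0
  by_contra! hlt
  have hr : 1 < a 1 / (C * a 0) := (one_lt_div (mul_pos hC h0)).2 hlt
  obtain ⟨N, hN⟩ := pow_unbounded_of_one_lt (M / a 0) hr
  have hle : (a 1 / (C * a 0)) ^ N ≤ (a 1 / (C * a 0)) ^ 2 ^ N :=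
    pow_le_pow_right₀ hr.le N.lt_two_pow_self.le
  have h1 : a 1 ^ 2 ^ N * a 0 ≤ a 0 ^ 2 ^ N * (M * C ^ 2 ^ N) :=
    (hpow N).trans (mul_le_mul_of_nonneg_left (hM _) (pow_nonneg h0.le _))
  have h2 : (a 1 / (C * a 0)) ^ 2 ^ N ≤ M / a 0 := by
    rw [div_pow, div_le_div_iff₀ (pow_pos (mul_pos hC h0) _) h0, mul_pow]
    linarith
  linarith

/-! ### Boundedness of formally adjoint weighted shifts -/

section WeightedShift

variable {X H : Type*} [NormedAddCommGroup H] [InnerProductSpace ℂ H]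

/-- A symmetric map whose iterates grow at most like `C ^ m` is bounded by `C`. -/
lemma norm_map_le_of_symmetric_of_iterate_le {V : Type*} [AddCommGroup V] [Module ℂ V]
    (e : V →ₗ[ℂ] H) (x : V →ₗ[ℂ] V) (hx : ∀ u v, ⟪e (x u), e v⟫_ℂ = ⟪e u, e (x v)⟫_ℂ)
    (v : V) {M C : ℝ} (hC : 0 < C) (hM : ∀ m : ℕ, ‖e ((x ^ m) v)‖ ≤ M * C ^ m) :
    ‖e (x v)‖ ≤ C * ‖e v‖ := by
  have hpow : ∀ (m : ℕ) u w, ⟪e ((x ^ m) u), e w⟫_ℂ = ⟪e u, e ((x ^ m) w)⟫_ℂ := by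
    intro m
    induction m with
    | zero => simp
    | succ m ih =>
      intro u w
      rw [pow_succ, Module.End.mul_apply, ih, hx, ← Module.End.mul_apply, ← pow_succ', pow_succ]
  have := le_mul_of_sq_le_mul_of_le_geometric (a := fun m => ‖e ((x ^ m) v)‖)
    (fun m => norm_nonneg _) (fun m => ?_) hC hM
  · simpa using this
  · have h : ‖e ((x ^ m) v)‖ ^ 2 = ‖⟪e v, e ((x ^ (2 * m)) v)⟫_ℂ‖ := by
      rw [two_mul, pow_add, Module.End.mul_apply, ← hpow, inner_self_eq_norm_sq_to_K]
      simp
    simp only [h, pow_zero, Module.End.one_apply]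
    exact norm_inner_le_norm _ _

/-- The linear extension of `δ_x ↦ a x • δ_(φ x)`. -/
def weightedShift (a : X → ℂ) (φ : X → X) : (X →₀ ℂ) →ₗ[ℂ] (X →₀ ℂ) :=
  Finsupp.linearCombination ℂ fun x => Finsupp.single (φ x) (a x)

@[simp]
lemma weightedShift_single (a : X → ℂ) (φ : X → X) (x : X) (r : ℂ) :
    weightedShift a φ (Finsupp.single x r) = Finsupp.single (φ x) (r * a x) := by
  simp [weightedShift]

lemma inner_weightedShift {k : X → H} {a b : X → ℂ} {φ ψ : X → X}
    (hadj : ∀ x y, ⟪a x • k (φ x), k y⟫_ℂ = ⟪k x, b y • k (ψ y)⟫_ℂ) (u v : X →₀ ℂ) :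
    ⟪Finsupp.linearCombination ℂ k (weightedShift a φ u), Finsupp.linearCombination ℂ k v⟫_ℂ =
      ⟪Finsupp.linearCombination ℂ k u, Finsupp.linearCombination ℂ k (weightedShift b ψ v)⟫_ℂ := by
  induction u using Finsupp.induction_linear with
  | zero => simp
  | add u₁ u₂ h₁ h₂ => simp only [map_add, inner_add_left, h₁, h₂]
  | single x r =>
    induction v using Finsupp.induction_linear with
    | zero => simp
    | add v₁ v₂ h₁ h₂ => simp only [map_add, inner_add_right, h₁, h₂]
    | single y s =>
      simp only [weightedShift_single, Finsupp.linearCombination_single, mul_smul, inner_smul_left,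
        inner_smul_right]
      have := hadj x y
      simp only [inner_smul_left, inner_smul_right] at this
      rw [this]
      ring

/-- If the weighted shifts `k x ↦ a x • k (φ x)` and `k x ↦ b x • k (ψ x)` on a total family `k`
are formally adjoint to each other and bounded on the family, then the first one extends to a
bounded operator. -/
theorem exists_continuousLinearMap_of_formal_adjoint [CompleteSpace H] {k : X → H}
    (hk : (Submodule.span ℂ (Set.range k)).topologicalClosure = ⊤) {a b : X → ℂ} {φ ψ : X → X}
    (hadj : ∀ x y, ⟪a x • k (φ x), k y⟫_ℂ = ⟪k x, b y • k (ψ y)⟫_ℂ) {Ca Cb : ℝ}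
    (hCa : 0 < Ca) (hCb : 0 < Cb) (ha : ∀ x, ‖a x‖ * ‖k (φ x)‖ ≤ Ca * ‖k x‖)
    (hb : ∀ x, ‖b x‖ * ‖k (ψ x)‖ ≤ Cb * ‖k x‖) :
    ∃ T : H →L[ℂ] H, ∀ x, T (k x) = a x • k (φ x) := by
  set e := Finsupp.linearCombination ℂ k with he
  set s := weightedShift b ψ with hs
  set t := weightedShift a φ with ht
  have hts : ∀ u v, ⟪e (t u), e v⟫_ℂ = ⟪e u, e (s v)⟫_ℂ := inner_weightedShift hadj
  have hst : ∀ u v, ⟪e (s u), e v⟫_ℂ = ⟪e u, e (t v)⟫_ℂ := fun u v => by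
    rw [← inner_conj_symm, ← hts v u, inner_conj_symm]
  -- Iterates of `s ∘ₗ t` keep multiples of basis vectors of this form, so the bounds `ha` and `hb`
  -- suffice.
  have hsingle : ∀ (m : ℕ) (x : X) (r : ℂ), ∃ (y : X) (q : ℂ),
      ((s ∘ₗ t) ^ m) (Finsupp.single x r) = Finsupp.single y q ∧
        ‖q‖ * ‖k y‖ ≤ (‖r‖ * ‖k x‖) * (Cb * Ca) ^ m := by
    intro m x r
    induction m with
    | zero => exact ⟨x, r, by simp, by simp⟩
    | succ m ih =>
      obtain ⟨y, q, hq, hle⟩ := ih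
      refine ⟨ψ (φ y), q * a y * b (φ y), ?_, ?_⟩
      · rw [pow_succ', Module.End.mul_apply, hq, LinearMap.comp_apply, ht, hs,
          weightedShift_single, weightedShift_single]
      · calc _ = ‖q‖ * ‖a y‖ * (‖b (φ y)‖ * ‖k (ψ (φ y))‖) := by simp only [norm_mul]; ring
          _ ≤ ‖q‖ * ‖a y‖ * (Cb * ‖k (φ y)‖) := mul_le_mul_of_nonneg_left (hb _) (by positivity)
          _ = ‖q‖ * Cb * (‖a y‖ * ‖k (φ y)‖) := by ring
          _ ≤ ‖q‖ * Cb * (Ca * ‖k y‖) := mul_le_mul_of_nonneg_left (ha _) (by positivity)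
          _ = Cb * Ca * (‖q‖ * ‖k y‖) := by ring
          _ ≤ Cb * Ca * ((‖r‖ * ‖k x‖) * (Cb * Ca) ^ m) := by gcongr
          _ = _ := by ring
  -- `M` may depend on `v`; only the rate `Cb * Ca` has to be uniform.
  have hgrowth : ∀ v : X →₀ ℂ, ∃ M : ℝ, ∀ m : ℕ, ‖e (((s ∘ₗ t) ^ m) v)‖ ≤ M * (Cb * Ca) ^ m := by
    intro v
    induction v using Finsupp.induction_linear with
    | zero => exact ⟨0, fun m => by simp⟩
    | add u v hu hv =>
      obtain ⟨M, hM⟩ := hu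
      obtain ⟨N, hN⟩ := hv
      refine ⟨M + N, fun m => ?_⟩
      rw [map_add, map_add, add_mul]
      exact (norm_add_le _ _).trans (add_le_add (hM m) (hN m))
    | single x r =>
      refine ⟨‖r‖ * ‖k x‖, fun m => ?_⟩
      obtain ⟨y, q, hq, hle⟩ := hsingle m x r
      rwa [hq, he, Finsupp.linearCombination_single, norm_smul]
  have hbound : ∀ v, ‖e (t v)‖ ≤ √(Cb * Ca) * ‖e v‖ := by
    intro v
    obtain ⟨M, hM⟩ := hgrowth v
    have h1 := norm_map_le_of_symmetric_of_iterate_le e (s ∘ₗ t) (fun u v => by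
      rw [LinearMap.comp_apply, LinearMap.comp_apply, hst, hts]) v (mul_pos hCb hCa) hM
    have h2 : ‖e (t v)‖ ^ 2 = ‖⟪e v, e ((s ∘ₗ t) v)⟫_ℂ‖ := by
      rw [LinearMap.comp_apply, ← hts, inner_self_eq_norm_sq_to_K]
      simp
    refine abs_le_of_sq_le_sq' ?_ (by positivity) |>.2
    rw [h2, mul_pow, Real.sq_sqrt (mul_pos hCb hCa).le]
    calc _ ≤ ‖e v‖ * ‖e ((s ∘ₗ t) v)‖ := norm_inner_le_norm _ _
      _ ≤ ‖e v‖ * (Cb * Ca * ‖e v‖) := by gcongr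
      _ = _ := by ring
  have hdense : DenseRange e := by
    have : (LinearMap.range e : Set H) = Set.range e := LinearMap.coe_range e
    rw [DenseRange, ← this, he, Finsupp.range_linearCombination]
    exact Submodule.dense_iff_topologicalClosure_eq_top.2 hk
  -- By `hbound`, `e ∘ₗ t` vanishes on the kernel of `e`, so linear relations among the `k x` are
  -- respected.
  refine ⟨(e ∘ₗ t).extendOfNorm e, fun x => ?_⟩
  have h := LinearMap.extendOfNorm_eq (f := e ∘ₗ t) hdense ⟨_, hbound⟩ (Finsupp.single x 1)
  simpa [he, ht] using h

end WeightedShift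

/-! ### Kernel functions and branches of the logarithm -/

section Kernel

variable {n : ℕ}

lemma re_one_sub_inner_pos (w z : UnitBall n) :
    0 < (1 - ⟪(w : Cn n), (z : Cn n)⟫_ℂ).re := by
  have := (Complex.re_le_norm _).trans_lt (norm_inner_ball_lt w z)
  simp only [Complex.sub_re, Complex.one_re]
  linarith

lemma one_sub_inner_ne_zero (w z : UnitBall n) : 1 - ⟪(w : Cn n), (z : Cn n)⟫_ℂ ≠ 0 := by
  intro h
  have := re_one_sub_inner_pos w z
  simp [h] at this

lemma one_sub_norm_sq_pos (z : UnitBall n) : 0 < 1 - ‖(z : Cn n)‖ ^ 2 := by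
  have hz := mem_ball_zero_iff.1 z.2
  nlinarith [norm_nonneg (z : Cn n)]

lemma one_sub_inner_self (z : UnitBall n) :
    1 - ⟪(z : Cn n), (z : Cn n)⟫_ℂ = ((1 - ‖(z : Cn n)‖ ^ 2 : ℝ) : ℂ) := by
  rw [inner_self_eq_norm_sq_to_K]
  simp

lemma ballKernel_eq_exp (γ : ℝ) (w z : UnitBall n) :
    ballKernel γ w z = Complex.exp (-(γ * Complex.log (1 - ⟪(w : Cn n), (z : Cn n)⟫_ℂ))) := by
  rw [ballKernel, Complex.cpow_def_of_ne_zero (one_sub_inner_ne_zero w z), Complex.exp_neg,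
    one_div, mul_comm]

lemma ballKernel_ne_zero (γ : ℝ) (w z : UnitBall n) : ballKernel γ w z ≠ 0 := by
  rw [ballKernel_eq_exp]
  exact Complex.exp_ne_zero _

@[simp]
lemma ballKernel_origin_left (γ : ℝ) (z : UnitBall n) :
    ballKernel γ (UnitBall.origin n) z = 1 := by
  simp [ballKernel, UnitBall.origin]

@[simp]
lemma ballKernel_origin_right (γ : ℝ) (w : UnitBall n) :
    ballKernel γ w (UnitBall.origin n) = 1 := by
  simp [ballKernel, UnitBall.origin]

lemma norm_ballKernel (γ : ℝ) (w z : UnitBall n) :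
    ‖ballKernel γ w z‖ = (‖1 - ⟪(w : Cn n), (z : Cn n)⟫_ℂ‖ ^ γ)⁻¹ := by
  rw [ballKernel, norm_div, norm_one, one_div]
  congr 1
  rw [Complex.norm_cpow_of_ne_zero (one_sub_inner_ne_zero w z)]
  simp

/-- Both factors lie in the right half-plane, so their arguments add up without leaving `(-π, π)`.
-/
lemma log_mul_one_sub_inner (w z w' z' : UnitBall n) :
    Complex.log ((1 - ⟪(w : Cn n), (z : Cn n)⟫_ℂ) * (1 - ⟪(w' : Cn n), (z' : Cn n)⟫_ℂ)) =
      Complex.log (1 - ⟪(w : Cn n), (z : Cn n)⟫_ℂ) +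
        Complex.log (1 - ⟪(w' : Cn n), (z' : Cn n)⟫_ℂ) := by
  refine Complex.log_mul (one_sub_inner_ne_zero _ _) (one_sub_inner_ne_zero _ _) ?_
  have h₁ := abs_lt.1 (Complex.abs_arg_lt_pi_div_two_iff.2 (Or.inl (re_one_sub_inner_pos w z)))
  have h₂ := abs_lt.1 (Complex.abs_arg_lt_pi_div_two_iff.2 (Or.inl (re_one_sub_inner_pos w' z')))
  exact ⟨by linarith, by linarith⟩

/-- Multiplicative relations between the factors `1 - ⟨z, w⟩` pass to the kernel, the arguments of
the factors being less than `π / 2` in absolute value. -/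
lemma ballKernel_mul_eq_mul (γ : ℝ) {w₁ z₁ w₂ z₂ w₃ z₃ w₄ z₄ : UnitBall n}
    (h : (1 - ⟪(w₁ : Cn n), (z₁ : Cn n)⟫_ℂ) * (1 - ⟪(w₂ : Cn n), (z₂ : Cn n)⟫_ℂ) =
      (1 - ⟪(w₃ : Cn n), (z₃ : Cn n)⟫_ℂ) * (1 - ⟪(w₄ : Cn n), (z₄ : Cn n)⟫_ℂ)) :
    ballKernel γ w₁ z₁ * ballKernel γ w₂ z₂ = ballKernel γ w₃ z₃ * ballKernel γ w₄ z₄ := by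
  have hl := congrArg Complex.log h
  rw [log_mul_one_sub_inner, log_mul_one_sub_inner] at hl
  simp only [ballKernel_eq_exp, ← Complex.exp_add]
  congr 1
  linear_combination (-(γ : ℂ)) * hl

/-- A continuous function on a preconnected space with values in `2πiℤ` is constant. -/
lemma eq_of_exp_eq_one {X : Type*} [TopologicalSpace X] [PreconnectedSpace X] {h : X → ℂ}
    (hc : Continuous h) (he : ∀ x, Complex.exp (h x) = 1) (x y : X) : h x = h y := by
  choose m hm using fun x => Complex.exp_eq_one_iff.1 (he x)
  have hmc : Continuous m := by
    rw [Int.isClosedEmbedding_coe_real.isInducing.continuous_iff]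
    have : (fun x => (m x : ℝ)) = fun x => (h x).im / (2 * Real.pi) := by
      funext x
      rw [hm x]
      have := Real.pi_ne_zero
      simp
    rw [Function.comp_def, this]
    fun_prop
  rw [hm x, hm y, PreconnectedSpace.constant ‹_› hmc (x := x) (y := y)]

instance : PreconnectedSpace (UnitBall n) :=
  isPreconnected_iff_preconnectedSpace.1 (convex_ball (0 : Cn n) 1).isPreconnected

lemma AnalyticOnBall.continuous {V : Type*} [NormedAddCommGroup V] [NormedSpace ℂ V]
    {F : UnitBall n → V} (hF : AnalyticOnBall F) : Continuous F := by
  obtain ⟨G, hG, h⟩ := hF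
  have : F = fun z : UnitBall n => G z := funext h
  rw [this]
  exact hG.continuousOn.comp_continuous continuous_subtype_val fun z => z.2

variable {γ : ℝ} [Fact (0 < γ)]

@[simp]
lemma inner_kerFun_one_left (w : UnitBall n) (h : HGamma n γ) :
    ⟪RKHS.kerFun (HGamma n γ) w 1, h⟫_ℂ = h w := by
  simp

lemma inner_kerFun_kerFun (z w : UnitBall n) :
    ⟪RKHS.kerFun (HGamma n γ) z 1, RKHS.kerFun (HGamma n γ) w 1⟫_ℂ = ballKernel γ w z := by
  rw [inner_kerFun_one_left, kerFun_HGamma_apply]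

lemma span_kerFun_topologicalClosure :
    (Submodule.span ℂ (Set.range fun w : UnitBall n =>
      RKHS.kerFun (HGamma n γ) w (1 : ℂ))).topologicalClosure = ⊤ := by
  rw [← top_le_iff, ← RKHS.kerFun_dense (HGamma n γ)]
  refine Submodule.topologicalClosure_mono (Submodule.span_le.2 ?_)
  rintro _ ⟨w, v, rfl⟩
  have : RKHS.kerFun (HGamma n γ) w v = v • RKHS.kerFun (HGamma n γ) w 1 := by
    rw [← map_smul, smul_eq_mul, mul_one]
  rw [this]
  exact Submodule.smul_mem _ _ (Submodule.subset_span ⟨w, rfl⟩)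

lemma norm_sq_kerFun (w : UnitBall n) :
    ‖RKHS.kerFun (HGamma n γ) w (1 : ℂ)‖ ^ 2 = ((1 - ‖(w : Cn n)‖ ^ 2) ^ γ)⁻¹ := by
  have h := congrArg norm (inner_kerFun_kerFun (γ := γ) w w)
  rw [norm_ballKernel, inner_self_eq_norm_sq_to_K, one_sub_inner_self, Complex.norm_real,
    Real.norm_of_nonneg (one_sub_norm_sq_pos w).le] at h
  simpa using h

end Kernel

/-! ### Necessity: weights and the kernel relation -/

section Forward

variable {n : ℕ} {γ : ℝ} [Fact (0 < γ)] {f g : UnitBall n → ℂ} {φ ψ : UnitBall n → UnitBall n}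

/-- Both sides compute `⟪K_z, S K_w⟫ = ⟪T K_z, K_w⟫`. -/
lemma WeightedCompAdjoint.kernel_eq (h : WeightedCompAdjoint γ f g φ ψ) (z w : UnitBall n) :
    f z * ballKernel γ w (φ z) = star (g w) * ballKernel γ (ψ w) z := by
  obtain ⟨S, T, hS, hT, -, -, hST⟩ := h
  rw [← kerFun_HGamma_apply, ← hS, ← inner_kerFun_one_left z, ← hST,
    ContinuousLinearMap.adjoint_inner_right, ← inner_conj_symm, inner_kerFun_one_left, hT,
    kerFun_HGamma_apply, ← ballKernel_conj γ z]
  simp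

lemma WeightedCompAdjoint.exists_ne_zero (h : WeightedCompAdjoint γ f g φ ψ) :
    ∃ z, f z ≠ 0 := by
  obtain ⟨S, T, hS, -, hS0, -⟩ := h
  by_contra! hf
  refine hS0 (ContinuousLinearMap.ext fun u => RKHS.ext fun z => ?_)
  rw [hS, hf]
  simp

/-- The weights are multiples of kernel functions. -/
lemma WeightedCompAdjoint.weights (h : WeightedCompAdjoint γ f g φ ψ) :
    f (UnitBall.origin n) ≠ 0 ∧
      (∀ z, f z = f (UnitBall.origin n) * ballKernel γ (ψ (UnitBall.origin n)) z) ∧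
      ∀ z, g z = star (f (UnitBall.origin n)) * ballKernel γ (φ (UnitBall.origin n)) z := by
  have h0 : f (UnitBall.origin n) = star (g (UnitBall.origin n)) := by
    simpa using h.kernel_eq (UnitBall.origin n) (UnitBall.origin n)
  have hf : ∀ z, f z = f (UnitBall.origin n) * ballKernel γ (ψ (UnitBall.origin n)) z := by
    intro z
    have := h.kernel_eq z (UnitBall.origin n)
    rwa [ballKernel_origin_left, mul_one, ← h0] at this
  refine ⟨fun h0 => ?_, hf, fun z => ?_⟩
  · obtain ⟨z, hz⟩ := h.exists_ne_zero
    rw [hf z, h0, zero_mul] at hz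
    exact hz rfl
  · have := congrArg star (h.kernel_eq (UnitBall.origin n) z)
    rw [ballKernel_origin_right, mul_one, star_star, star_mul', ballKernel_conj] at this
    exact this.symm

/-- The symbols of adjoint weighted composition operators satisfy the kernel relation with the
power `γ` removed. -/
lemma WeightedCompAdjoint.one_sub_mul_one_sub (h : WeightedCompAdjoint γ f g φ ψ)
    (hφ : Continuous φ) (z w : UnitBall n) :
    (1 - ⟪(ψ (UnitBall.origin n) : Cn n), (z : Cn n)⟫_ℂ) *
        (1 - ⟪(w : Cn n), (φ z : Cn n)⟫_ℂ) =
      (1 - ⟪(w : Cn n), (φ (UnitBall.origin n) : Cn n)⟫_ℂ) *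
        (1 - ⟪(ψ w : Cn n), (z : Cn n)⟫_ℂ) := by
  obtain ⟨h0, hf, hg⟩ := h.weights
  set c := ψ (UnitBall.origin n)
  set d := φ (UnitBall.origin n)
  have hK : ∀ z, ballKernel γ c z * ballKernel γ w (φ z) =
      ballKernel γ w d * ballKernel γ (ψ w) z := by
    intro z
    have := h.kernel_eq z w
    rw [hf z, hg w, star_mul', star_star, ballKernel_conj] at this
    refine mul_left_cancel₀ h0 ?_
    linear_combination this
  -- `Λ` is the logarithm of the left side minus that of the right. By `hK`, `-γΛ` takes values in
  -- `2πiℤ`; it is continuous and vanishes at the origin, so `Λ = 0`.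
  let Λ : UnitBall n → ℂ := fun z =>
    Complex.log (1 - ⟪(c : Cn n), (z : Cn n)⟫_ℂ) + Complex.log (1 - ⟪(w : Cn n), (φ z : Cn n)⟫_ℂ) -
      (Complex.log (1 - ⟪(w : Cn n), (d : Cn n)⟫_ℂ) +
        Complex.log (1 - ⟪(ψ w : Cn n), (z : Cn n)⟫_ℂ))
  have hΛ : Continuous Λ := by
    have hlog : ∀ (u : UnitBall n) {F : UnitBall n → UnitBall n}, Continuous F →
        Continuous fun z => Complex.log (1 - ⟪(u : Cn n), (F z : Cn n)⟫_ℂ) := fun u F hF =>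
      Continuous.clog (by fun_prop) fun z => Or.inl (re_one_sub_inner_pos u (F z))
    exact ((hlog c continuous_id).add (hlog w hφ)).sub
      (continuous_const.add (hlog (ψ w) continuous_id))
  have hexp : ∀ z, Complex.exp (-(γ * Λ z)) = 1 := by
    intro z
    have := hK z
    simp only [ballKernel_eq_exp, ← Complex.exp_add] at this
    rw [← sub_eq_zero, ← sub_eq_zero.2 this]
    have e : -(γ * Λ z) = -(γ * Complex.log (1 - ⟪(c : Cn n), (z : Cn n)⟫_ℂ)) +
        -(γ * Complex.log (1 - ⟪(w : Cn n), (φ z : Cn n)⟫_ℂ)) -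
        (-(γ * Complex.log (1 - ⟪(w : Cn n), (d : Cn n)⟫_ℂ)) +
        -(γ * Complex.log (1 - ⟪(ψ w : Cn n), (z : Cn n)⟫_ℂ))) := by simp only [Λ]; ring
    rw [e, Complex.exp_sub, this, div_self (Complex.exp_ne_zero _), sub_self, sub_self]
  have hconst := eq_of_exp_eq_one (h := fun z => -(γ * Λ z)) (by fun_prop) hexp z
    (UnitBall.origin n)
  have hzero : Λ (UnitBall.origin n) = 0 := by
    simp only [Λ, UnitBall.origin, inner_zero_right, sub_zero, Complex.log_one]
    change 0 + Complex.log (1 - ⟪(w : Cn n), (d : Cn n)⟫_ℂ) - _ = 0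
    ring
  have hγ : (γ : ℂ) ≠ 0 := Complex.ofReal_ne_zero.2 (Fact.out : 0 < γ).ne'
  have hz : Λ z = 0 := by
    simpa [hzero, hγ] using hconst
  have := congrArg Complex.exp (sub_eq_zero.1 hz)
  rwa [Complex.exp_add, Complex.exp_add, Complex.exp_log (one_sub_inner_ne_zero _ _),
    Complex.exp_log (one_sub_inner_ne_zero _ _), Complex.exp_log (one_sub_inner_ne_zero _ _),
    Complex.exp_log (one_sub_inner_ne_zero _ _)] at this

end Forward

/-! ### Formally adjoint maps on the ball are linear -/

section Linear

variable {n : ℕ}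

/-- Vectors with the same inner products against the ball are equal. -/
lemma eq_of_forall_inner_ball {u v : Cn n}
    (h : ∀ w : UnitBall n, ⟪(w : Cn n), u⟫_ℂ = ⟪(w : Cn n), v⟫_ℂ) : u = v := by
  refine ext_inner_left ℂ fun x => ?_
  obtain ⟨r, hr, hx⟩ : ∃ r : ℂ, r ≠ 0 ∧ r • x ∈ Metric.ball (0 : Cn n) 1 := by
    have hpos : 0 < 1 + ‖x‖ := by positivity
    refine ⟨((1 + ‖x‖)⁻¹ : ℝ), Complex.ofReal_ne_zero.2 (inv_ne_zero hpos.ne'), ?_⟩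
    rw [mem_ball_zero_iff, norm_smul, Complex.norm_real, Real.norm_of_nonneg (by positivity),
      inv_mul_lt_one₀ hpos]
    linarith
  have := h ⟨_, hx⟩
  simp only [inner_smul_left] at this
  exact mul_left_cancel₀ ((map_ne_zero _).2 hr) this

/-- Two maps on the ball that are formally adjoint to each other are restrictions of a linear map
and its adjoint. -/
lemma exists_linearMap_of_formal_adjoint {F G : UnitBall n → Cn n}
    (h : ∀ z w : UnitBall n, ⟪(w : Cn n), F z⟫_ℂ = ⟪G w, (z : Cn n)⟫_ℂ) :
    ∃ A : Cn n →ₗ[ℂ] Cn n, (∀ z : UnitBall n, F z = A z) ∧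
      ∀ w : UnitBall n, G w = LinearMap.adjoint A w := by
  have hmem : ∀ i : Fin n, (2⁻¹ : ℂ) • EuclideanSpace.single i (1 : ℂ) ∈
      Metric.ball (0 : Cn n) 1 := by
    intro i
    rw [mem_ball_zero_iff, norm_smul]
    simp
    norm_num
  -- Coordinate `i` of `F z` is `2 ⟪e_i / 2, F z⟫ = 2 ⟪G (e_i / 2), z⟫`, linear in `z`; halving puts
  -- `e_i` into the open ball.
  let A : Cn n →ₗ[ℂ] Cn n := ∑ i : Fin n,
    ((2 : ℂ) • (innerSL ℂ (G ⟨_, hmem i⟩)).toLinearMap).smulRight (EuclideanSpace.single i (1 : ℂ))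
  have hA : ∀ z : UnitBall n, F z = A z := by
    intro z
    ext i
    have := h z ⟨_, hmem i⟩
    simp only [inner_smul_left, EuclideanSpace.inner_single_left] at this
    have h2 : (starRingEnd ℂ) 2 = 2 := map_ofNat _ 2
    simp [A, ← this, Pi.single_apply, h2]
  refine ⟨A, hA, fun w => eq_of_forall_inner_ball fun z => ?_⟩
  rw [LinearMap.adjoint_inner_right, ← hA, ← inner_conj_symm, ← h, inner_conj_symm]

end Linear

/-! ### Sufficiency: bounded adjoint operators from the kernel relation -/

section Bounded

variable {n : ℕ} {γ : ℝ} [Fact (0 < γ)]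

/-- The growth estimate that makes a weighted composition operator bounded on the kernel
functions. -/
lemma exists_norm_mul_norm_kerFun_le {c d : UnitBall n} {φ ψ : UnitBall n → UnitBall n}
    (hrel : ∀ z w : UnitBall n, (1 - ⟪(c : Cn n), (z : Cn n)⟫_ℂ) *
        (1 - ⟪(w : Cn n), (φ z : Cn n)⟫_ℂ) =
      (1 - ⟪(w : Cn n), (d : Cn n)⟫_ℂ) * (1 - ⟪(ψ w : Cn n), (z : Cn n)⟫_ℂ))
    {a : UnitBall n → ℂ} {α : ℂ} (ha : ∀ z, ‖a z‖ = ‖α‖ * ‖ballKernel γ c z‖) :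
    ∃ C : ℝ, 0 < C ∧ ∀ z, ‖a z‖ * ‖RKHS.kerFun (HGamma n γ) (φ z) (1 : ℂ)‖ ≤
      C * ‖RKHS.kerFun (HGamma n γ) z (1 : ℂ)‖ := by
  have hγ : 0 < γ := Fact.out
  have hlow : ∀ u z : UnitBall n, 1 - ‖(u : Cn n)‖ ≤ ‖1 - ⟪(u : Cn n), (z : Cn n)⟫_ℂ‖ := by
    intro u z
    have h1 := norm_sub_norm_le (1 : ℂ) ⟪(u : Cn n), (z : Cn n)⟫_ℂ
    have h2 := norm_inner_le_norm (𝕜 := ℂ) (u : Cn n) (z : Cn n)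
    have hz := mem_ball_zero_iff.1 z.2
    rw [norm_one] at h1
    nlinarith [norm_nonneg (u : Cn n)]
  have hc : 0 < 1 - ‖(c : Cn n)‖ := sub_pos.2 (mem_ball_zero_iff.1 c.2)
  have hd : 0 < 1 - ‖(d : Cn n)‖ := sub_pos.2 (mem_ball_zero_iff.1 d.2)
  -- The 4 combines `|1 - ⟨z, c⟩| ≤ 2` with `1 - ‖z‖² ≤ 2 (1 - ‖z‖)`.
  set δ := (1 - ‖(d : Cn n)‖) / 4 with hδ
  have hδ0 : 0 < δ := by positivity
  -- A Schwarz–Pick type estimate: take `w = φ z` in the relation and bound the two factors on the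
  -- right from below.
  have hSP : ∀ z : UnitBall n, δ * (1 - ‖(z : Cn n)‖ ^ 2) ≤ 1 - ‖(φ z : Cn n)‖ ^ 2 := by
    intro z
    have h := congrArg norm (hrel z (φ z))
    rw [norm_mul, norm_mul, one_sub_inner_self, Complex.norm_real,
      Real.norm_of_nonneg (one_sub_norm_sq_pos _).le] at h
    have h1 : ‖1 - ⟪(c : Cn n), (z : Cn n)⟫_ℂ‖ ≤ 2 := by
      refine (norm_sub_le _ _).trans ?_
      rw [norm_one]
      linarith [norm_inner_ball_lt c z]
    have h2 : 1 - ‖(d : Cn n)‖ ≤ ‖1 - ⟪(φ z : Cn n), (d : Cn n)⟫_ℂ‖ := by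
      rw [← Complex.norm_conj, map_sub, map_one, inner_conj_symm]
      exact hlow d (φ z)
    have h3 : 1 - ‖(z : Cn n)‖ ≤ ‖1 - ⟪(ψ (φ z) : Cn n), (z : Cn n)⟫_ℂ‖ := by
      rw [← Complex.norm_conj, map_sub, map_one, inner_conj_symm]
      exact hlow z _
    have hz := mem_ball_zero_iff.1 z.2
    have h4 : (1 - ‖(d : Cn n)‖) * (1 - ‖(z : Cn n)‖) ≤ 2 * (1 - ‖(φ z : Cn n)‖ ^ 2) := by
      calc _ ≤ ‖1 - ⟪(φ z : Cn n), (d : Cn n)⟫_ℂ‖ * ‖1 - ⟪(ψ (φ z) : Cn n), (z : Cn n)⟫_ℂ‖ :=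
            mul_le_mul h2 h3 (by linarith) (norm_nonneg _)
        _ = _ := h.symm
        _ ≤ _ := mul_le_mul_of_nonneg_right h1 (one_sub_norm_sq_pos _).le
    have h5 : 1 - ‖(z : Cn n)‖ ^ 2 ≤ 2 * (1 - ‖(z : Cn n)‖) := by nlinarith
    have h6 := mul_le_mul_of_nonneg_left h5 hd.le
    rw [hδ]
    linarith
  have hN : ∀ z, ‖RKHS.kerFun (HGamma n γ) (φ z) (1 : ℂ)‖ ≤
      √((δ ^ γ)⁻¹) * ‖RKHS.kerFun (HGamma n γ) z (1 : ℂ)‖ := by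
    intro z
    refine abs_le_of_sq_le_sq' ?_ (by positivity) |>.2
    have hz := one_sub_norm_sq_pos z
    rw [mul_pow, Real.sq_sqrt (by positivity), norm_sq_kerFun, norm_sq_kerFun, ← mul_inv,
      ← Real.mul_rpow hδ0.le hz.le]
    exact inv_anti₀ (by positivity) (Real.rpow_le_rpow (by positivity) (hSP z) hγ.le)
  -- The `+ 1` keeps the constant positive even when `α = 0`.
  have hA : ∀ z, ‖a z‖ ≤ (‖α‖ + 1) * ((1 - ‖(c : Cn n)‖) ^ γ)⁻¹ := by
    intro z
    rw [ha, norm_ballKernel]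
    refine mul_le_mul (by linarith) ?_ (by positivity) (by positivity)
    exact inv_anti₀ (by positivity) (Real.rpow_le_rpow hc.le (hlow c z) hγ.le)
  refine ⟨(‖α‖ + 1) * ((1 - ‖(c : Cn n)‖) ^ γ)⁻¹ * √((δ ^ γ)⁻¹), by positivity, fun z => ?_⟩
  rw [mul_assoc]
  exact mul_le_mul (hA z) (hN z) (norm_nonneg _) (by positivity)

/-- Kernel-function weights and symbols that satisfy the kernel relation give adjoint weighted
composition operators. -/
lemma weightedCompAdjoint_of_relation {c d : UnitBall n} {φ ψ : UnitBall n → UnitBall n}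
    {f g : UnitBall n → ℂ} {α : ℂ} (hα : α ≠ 0)
    (hrel : ∀ z w : UnitBall n, (1 - ⟪(c : Cn n), (z : Cn n)⟫_ℂ) *
        (1 - ⟪(w : Cn n), (φ z : Cn n)⟫_ℂ) =
      (1 - ⟪(w : Cn n), (d : Cn n)⟫_ℂ) * (1 - ⟪(ψ w : Cn n), (z : Cn n)⟫_ℂ))
    (hf : ∀ z, f z = α * ballKernel γ c z) (hg : ∀ z, g z = star α * ballKernel γ d z) :
    WeightedCompAdjoint γ f g φ ψ := by
  have hrel' : ∀ z w : UnitBall n, (1 - ⟪(d : Cn n), (z : Cn n)⟫_ℂ) *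
        (1 - ⟪(w : Cn n), (ψ z : Cn n)⟫_ℂ) =
      (1 - ⟪(w : Cn n), (c : Cn n)⟫_ℂ) * (1 - ⟪(φ w : Cn n), (z : Cn n)⟫_ℂ) := by
    intro z w
    have := congrArg (starRingEnd ℂ) (hrel w z)
    simpa only [map_mul, map_sub, map_one, inner_conj_symm] using this.symm
  have hker : ∀ z w, f z * ballKernel γ w (φ z) = star (g w) * ballKernel γ (ψ w) z := by
    intro z w
    rw [hf, hg, star_mul', star_star, ballKernel_conj, mul_assoc, mul_assoc,
      ballKernel_mul_eq_mul γ (hrel z w)]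
  set k : UnitBall n → HGamma n γ := fun w => RKHS.kerFun (HGamma n γ) w (1 : ℂ) with hk
  have hkk : ∀ z w, ⟪k z, k w⟫_ℂ = ballKernel γ w z := inner_kerFun_kerFun
  have hkl : ∀ z (h : HGamma n γ), ⟪k z, h⟫_ℂ = h z := inner_kerFun_one_left
  obtain ⟨Ca, hCa, hCa'⟩ := exists_norm_mul_norm_kerFun_le hrel (a := fun z => star (f z)) (α := α)
    (fun z => by rw [norm_star, hf, norm_mul])
  obtain ⟨Cb, hCb, hCb'⟩ := exists_norm_mul_norm_kerFun_le hrel' (a := fun z => star (g z)) (α := α)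
    (fun z => by rw [norm_star, hg, norm_mul, norm_star])
  -- The adjoint of `W_{f,φ}` must send `K_z` to `conj (f z) • K_{φ z}`, so `T` is built from this
  -- rule.
  obtain ⟨T, hT⟩ := exists_continuousLinearMap_of_formal_adjoint (k := k)
    span_kerFun_topologicalClosure (a := fun z => star (f z)) (b := fun z => star (g z))
    (fun z w => by simpa [inner_smul_left, inner_smul_right, hkk, mul_comm] using hker z w)
    hCa hCb hCa' hCb'
  have hS : IsWeightedComp f φ (ContinuousLinearMap.adjoint T) := by
    intro h z
    rw [← hkl, ContinuousLinearMap.adjoint_inner_right, hT, inner_smul_left, hkl]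
    simp
  -- By `hker`, the adjoint of `T` acts on kernel functions as the shift for `g` and `ψ`; this
  -- identifies `T` with `W_{g,ψ}`.
  have hSk : ∀ w, ContinuousLinearMap.adjoint T (k w) = star (g w) • k (ψ w) := by
    intro w
    refine RKHS.ext fun z => ?_
    rw [hS, ← hkl, hkk, RKHS.coe_smul, Pi.smul_apply, ← hkl, hkk, hker, smul_eq_mul]
  have hT' : IsWeightedComp g ψ T := by
    intro h w
    rw [← hkl, ← ContinuousLinearMap.adjoint_inner_left, hSk, inner_smul_left, hkl]
    simp
  have hne : ∀ {u : UnitBall n → ℂ} {χ : UnitBall n → UnitBall n} {R : HGamma n γ →L[ℂ] HGamma n γ},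
      IsWeightedComp u χ R → (∀ z, u z ≠ 0) → R ≠ 0 := by
    rintro u χ _ hR hu rfl
    have h := hR (k (UnitBall.origin n)) (UnitBall.origin n)
    rw [← hkl (χ _), hkk, ballKernel_origin_left, mul_one] at h
    exact hu _ (by simpa using h.symm)
  refine ⟨_, T, hS, hT', hne hS fun z => ?_, hne hT' fun z => ?_, rfl⟩
  · rw [hf]
    exact mul_ne_zero hα (ballKernel_ne_zero _ _ _)
  · rw [hg]
    exact mul_ne_zero (star_ne_zero.2 hα) (ballKernel_ne_zero _ _ _)

end Bounded

/-! ### Kernel relation and linear fractional form -/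

section LinearFractional

variable {n : ℕ} {φ ψ : UnitBall n → UnitBall n} {c d : UnitBall n} {A : Cn n →ₗ[ℂ] Cn n}

/-- With denominators cleared, both sides are `1 - ⟨z, c⟩ - ⟨d, w⟩ - ⟨A z, w⟩`. -/
lemma one_sub_mul_one_sub_of_linFrac
    (hφ : ∀ z : UnitBall n, (φ z : Cn n) =
      (1 - ⟪(c : Cn n), (z : Cn n)⟫_ℂ)⁻¹ • ((d : Cn n) + A z))
    (hψ : ∀ z : UnitBall n, (ψ z : Cn n) =
      (1 - ⟪(d : Cn n), (z : Cn n)⟫_ℂ)⁻¹ • ((c : Cn n) + LinearMap.adjoint A z))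
    (z w : UnitBall n) :
    (1 - ⟪(c : Cn n), (z : Cn n)⟫_ℂ) * (1 - ⟪(w : Cn n), (φ z : Cn n)⟫_ℂ) =
      (1 - ⟪(w : Cn n), (d : Cn n)⟫_ℂ) * (1 - ⟪(ψ w : Cn n), (z : Cn n)⟫_ℂ) := by
  rw [hφ, hψ]
  simp only [inner_smul_left, inner_smul_right, inner_add_left, inner_add_right, map_inv₀, map_sub,
    map_one, inner_conj_symm, LinearMap.adjoint_inner_left, mul_sub, mul_one]
  rw [mul_inv_cancel_left₀ (one_sub_inner_ne_zero _ _),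
    mul_inv_cancel_left₀ (one_sub_inner_ne_zero _ _)]
  ring

lemma exists_linFrac_of_one_sub_mul_one_sub
    (hrel : ∀ z w : UnitBall n, (1 - ⟪(c : Cn n), (z : Cn n)⟫_ℂ) *
        (1 - ⟪(w : Cn n), (φ z : Cn n)⟫_ℂ) =
      (1 - ⟪(w : Cn n), (d : Cn n)⟫_ℂ) * (1 - ⟪(ψ w : Cn n), (z : Cn n)⟫_ℂ)) :
    ∃ A : Cn n →ₗ[ℂ] Cn n,
      (∀ z : UnitBall n, (φ z : Cn n) =
        (1 - ⟪(c : Cn n), (z : Cn n)⟫_ℂ)⁻¹ • ((d : Cn n) + A z)) ∧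
      ∀ z : UnitBall n, (ψ z : Cn n) =
        (1 - ⟪(d : Cn n), (z : Cn n)⟫_ℂ)⁻¹ • ((c : Cn n) + LinearMap.adjoint A z) := by
  obtain ⟨A, hA, hA'⟩ := exists_linearMap_of_formal_adjoint
    (F := fun z => (1 - ⟪(c : Cn n), (z : Cn n)⟫_ℂ) • (φ z : Cn n) - d)
    (G := fun z => (1 - ⟪(d : Cn n), (z : Cn n)⟫_ℂ) • (ψ z : Cn n) - c) (by
      intro z w
      have := hrel z w
      simp only [inner_sub_left, inner_sub_right, inner_smul_left, inner_smul_right, map_sub,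
        map_one, inner_conj_symm]
      linear_combination -this)
  refine ⟨A, fun z => ?_, fun z => ?_⟩
  · rw [← hA, add_sub_cancel, inv_smul_smul₀ (one_sub_inner_ne_zero _ _)]
  · rw [← hA', add_sub_cancel, inv_smul_smul₀ (one_sub_inner_ne_zero _ _)]

lemma LinFrac.represents_of_eq
    (hφ : ∀ z : UnitBall n, (φ z : Cn n) =
      (1 - ⟪(c : Cn n), (z : Cn n)⟫_ℂ)⁻¹ • ((d : Cn n) + A z)) :
    (LinFrac.mk A d (-c) 1).Represents φ := by
  intro z
  have e : (LinFrac.mk A d (-c) 1).denom z = 1 - ⟪(c : Cn n), (z : Cn n)⟫_ℂ := by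
    simp only [LinFrac.denom, inner_neg_left]
    ring
  rw [e, hφ, add_comm]
  exact ⟨one_sub_inner_ne_zero _ _, rfl⟩

end LinearFractional

end

theorem theorem5p2 (n : ℕ) (γ : ℝ) [Fact (0 < γ)]
    (f g : UnitBall n → ℂ) (φ ψ : UnitBall n → UnitBall n)
    (hf : AnalyticOnBall f) (hg : AnalyticOnBall g)
    (hφ : AnalyticOnBall fun z => (φ z : Cn n)) (hψ : AnalyticOnBall fun z => (ψ z : Cn n)) :
    (WeightedCompAdjoint γ f g φ ψ ↔
      ∃ (c d : UnitBall n) (A : Cn n →ₗ[ℂ] Cn n) (α : ℂ), α ≠ 0 ∧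
        (∀ z : UnitBall n, (φ z : Cn n) =
          (1 - inner ℂ (c : Cn n) (z : Cn n))⁻¹ • ((d : Cn n) + A z)) ∧
        (∀ z : UnitBall n, (ψ z : Cn n) =
          (1 - inner ℂ (d : Cn n) (z : Cn n))⁻¹ • ((c : Cn n) + LinearMap.adjoint A z)) ∧
        c = ψ (UnitBall.origin n) ∧ d = φ (UnitBall.origin n) ∧
        (∀ z : UnitBall n, f z = α * ballKernel γ c z) ∧
        (∀ z : UnitBall n, g z = star α * ballKernel γ d z)) ∧
    (WeightedCompAdjoint γ f g φ ψ → IsLinFracMap φ ∧ IsLinFracMap ψ ∧ IsAdjointMap φ ψ) := by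
  have hrel := fun h : WeightedCompAdjoint γ f g φ ψ =>
    h.one_sub_mul_one_sub (hφ.continuous.subtype_mk fun z => (φ z).2)
  refine ⟨⟨fun h => ?_, ?_⟩, fun h => ?_⟩
  · obtain ⟨A, hA, hA'⟩ := exists_linFrac_of_one_sub_mul_one_sub (hrel h)
    obtain ⟨h0, hf', hg'⟩ := h.weights
    exact ⟨_, _, A, _, h0, hA, hA', rfl, rfl, hf', hg'⟩
  · rintro ⟨c, d, A, α, hα, hA, hA', -, -, hf', hg'⟩
    exact weightedCompAdjoint_of_relation hα (one_sub_mul_one_sub_of_linFrac hA hA') hf' hg'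
  · obtain ⟨A, hA, hA'⟩ := exists_linFrac_of_one_sub_mul_one_sub (hrel h)
    refine ⟨⟨_, LinFrac.represents_of_eq hA⟩, ⟨_, LinFrac.represents_of_eq hA'⟩,
      _, LinFrac.represents_of_eq hA, ?_⟩
    -- The adjoint of the coefficients `(A, d, -c, 1)` is `(A*, c, -d, 1)`: the same form with `c`
    -- and `d` exchanged.
    simpa [LinFrac.adjoint] using LinFrac.represents_of_eq hA'
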